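/- Let $m$ be a positive integer and put $$c_m = \frac{2}{m+1}\sum_{1\le j\le m,\ j\text{ odd}}\cot\Bigl(\frac{\pi j}{2m+2}\Bigr),$$ which is a positive real number. (i) For all real numbers $x$, $$\sum_{1\le k\le m,\ k\text{ odd}}\frac{2}{(m+1)^2}\cot\Bigl(\frac{\pi k}{2m+2}\Bigr)\bigl[(m+1-k)\sin kx+k\sin (m+1-k)x\bigr]\le 1 .$$ The left-hand side can be written, as a function of $x$, in exactly one way as $\sum_{k=1}^m a_k\sin kx$ with real coefficients $a_1,\dots,a_m$; all the $a_k$ are nonnegative, and $\sum_{k=1}^m a_k=c_m$. (ii) For every Borel probability measure $\mu$ on the real line, $$\min_{1\le k\le m}\int_{\mathbb R}\sin kx\,d\mu(x)\le\frac1{c_m}.$$ This bound is optimal: the measure $\mu_m$ with mass $\frac{2}{(m+1)c_m}\cot\bigl(\frac{\pi j}{2m+2}\bigr)$ at $\frac{\pi j}{m+1}$ for every odd $1\le j\le m$ (and no other mass) is a probability measure for which equality holds. Moreover, the inequality in (i) is the optimal one of its form: if real numbers $b_1,\dots,b_m$ satisfy $\sum_{k=1}^m b_k\sin kx\le 1$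 for all real $x$, then $\sum_{k=1}^m b_k\le c_m=\sum_{k=1}^m a_k$. -/

import Mathlib

noncomputable section

/-- The odd integers `j` with `1 ≤ j ≤ m`. -/
def oddIcc (m : ℕ) : Finset ℕ := (Finset.Icc 1 m).filter Odd

/-- The cotangent-weighted sum of sines
`∑_{k odd, 1 ≤ k ≤ m} 2/(m+1)² · cot(πk/(2m+2)) · [(m+1-k) sin kx + k sin (m+1-k)x]`. -/
def cotSineSum (m : ℕ) (x : ℝ) : ℝ :=
  ∑ k ∈ oddIcc m, 2 / ((m : ℝ) + 1) ^ 2 * Real.cot (Real.pi * k / (2 * (m : ℝ) + 2)) *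
    (((m : ℝ) + 1 - k) * Real.sin (k * x) + k * Real.sin (((m : ℝ) + 1 - k) * x))

/-- The constant `c_m = 2/(m+1) · ∑_{j odd, 1 ≤ j ≤ m} cot(πj/(2m+2))`. -/
def cotConst (m : ℕ) : ℝ :=
  2 / ((m : ℝ) + 1) * ∑ j ∈ oddIcc m, Real.cot (Real.pi * j / (2 * (m : ℝ) + 2))

/-- `min_{1 ≤ k ≤ m} E_μ sin kx`, for `m ≥ 1`. -/
def minSineExpectation (m : ℕ) (hm : 1 ≤ m) (μ : MeasureTheory.Measure ℝ) : ℝ :=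
  (Finset.Icc 1 m).inf' (Finset.nonempty_Icc.mpr hm) fun k => ∫ x, Real.sin ((k : ℝ) * x) ∂μ

/-- The measure with mass `2/((m+1) c_m) · cot(πj/(2m+2))` at `πj/(m+1)` for every odd
`1 ≤ j ≤ m`. -/
def cotMeasure (m : ℕ) : MeasureTheory.Measure ℝ :=
  ∑ j ∈ oddIcc m,
    ENNReal.ofReal (2 / (((m : ℝ) + 1) * cotConst m) *
      Real.cot (Real.pi * j / (2 * (m : ℝ) + 2))) •
    MeasureTheory.Measure.dirac (Real.pi * j / ((m : ℝ) + 1))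

end

/-!
Write `N = m + 1` and `x_j = π j / N` for odd `j`. Everything rests on the duality between the
sine polynomial `cotSineSum m` and the measure `cotMeasure m` carried by the nodes `x_j` in
`(0, π)`.

The sine polynomial is the Hermite–Fejér interpolant of the sign function at the `N` nodes `x_j`
modulo `2π`: it equals `∑ (K (x - x_j) - K (x + x_j))` over odd `j ≤ m`, where `K` is the
normalized Fejér kernel (`cotSineSum_eq_sum_fejerKernel`). To see this one expands `K` in cosines
and evaluates `∑ sin (k x_j)` by telescoping (`two_mul_sum_sin_odd_nodes`). Since `K` is nonnegative
(`fejerKernel_nonneg`) and its `N` translates to the nodes sum to `1` (`sum_fejerKernel`), the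
polynomial is at most `1`. Its coefficients `cotSineCoeff m k` are visibly nonnegative and sum to
`cotConst m`, and they are unique by discrete orthogonality of the sines (`sum_sin_mul_sin`).
Integrating the inequality against a probability measure bounds a weighted mean of the sine
moments, hence their minimum, by `1 / cotConst m`.

On the dual side, all sine moments of order `1, …, m` of the cotangent weights agree
(`sum_cot_mul_sin`), because `cot (x / 2) * (sin ((k + 1) x) - sin (k x))` equals
`cos ((k + 1) x) + cos (k x)`, and the sums of these over the nodes vanish for `k ≥ 1`. So
`cotMeasure m` gives equality, and testing any sine polynomial bounded by `1` against these weights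
bounds the sum of its coefficients.
-/

/-! ### Telescoping trigonometric sums -/

theorem two_sin_mul_sum_cos (A θ : ℝ) (n : ℕ) :
    2 * Real.sin θ * ∑ i ∈ Finset.range n, Real.cos (A - (2 * (i : ℝ) + 1) * θ) =
      Real.sin A - Real.sin (A - 2 * n * θ) := by
  induction n with
  | zero => simp
  | succ n ih =>
    rw [Finset.sum_range_succ, mul_add, ih]
    have e1 : A - 2 * n * θ = (A - (2 * (n : ℝ) + 1) * θ) + θ := by ring
    have e2 : A - 2 * ((n + 1 : ℕ) : ℝ) * θ = (A - (2 * (n : ℝ) + 1) * θ) - θ := by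
      push_cast; ring
    rw [e1, e2, Real.sin_add _ θ, Real.sin_sub _ θ]
    ring

theorem two_sin_mul_sum_sin (θ : ℝ) (n : ℕ) :
    2 * Real.sin θ * ∑ i ∈ Finset.range n, Real.sin ((2 * (i : ℝ) + 1) * θ) =
      1 - Real.cos (2 * n * θ) := by
  induction n with
  | zero => simp
  | succ n ih =>
    rw [Finset.sum_range_succ, mul_add, ih]
    have e1 : 2 * n * θ = (2 * (n : ℝ) + 1) * θ - θ := by ring
    have e2 : 2 * ((n + 1 : ℕ) : ℝ) * θ = (2 * (n : ℝ) + 1) * θ + θ := by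
      push_cast; ring
    rw [e1, e2, Real.cos_add _ θ, Real.cos_sub _ θ]
    ring

/-- A frequency `l` that is not a multiple of `n` sums to zero over any translate of the `n` odd
multiples of `π / n`; the hypothesis on the sine expresses that `n` does not divide `l`. -/
theorem sum_cos_shift_eq_zero (A : ℝ) (l : ℤ) (n : ℕ) (hn : 0 < n)
    (hl : Real.sin (l * Real.pi / n) ≠ 0) :
    ∑ i ∈ Finset.range n, Real.cos (A - (2 * (i : ℝ) + 1) * (l * Real.pi / n)) = 0 := by
  have h := two_sin_mul_sum_cos A (l * Real.pi / n) n
  have hn' : (n : ℝ) ≠ 0 := by positivity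
  have e : A - 2 * n * (l * Real.pi / n) = A - l * (2 * Real.pi) := by field_simp
  rw [e, Real.sin_sub_int_mul_two_pi, sub_self] at h
  simpa [hl] using h

theorem sin_mul_pi_div_ne_zero {l : ℤ} {n : ℕ} (h0 : l ≠ 0) (h1 : |l| < n) :
    Real.sin (l * Real.pi / n) ≠ 0 := by
  have hn : (0 : ℝ) < n := by
    have : (0 : ℤ) < n := lt_of_le_of_lt (abs_nonneg l) h1
    exact_mod_cast this
  rw [Real.sin_ne_zero_iff]
  intro k hk
  have hk' : (k : ℝ) * n = l := by
    have := Real.pi_ne_zero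
    field_simp at hk
    linarith
  have hk2 : k * n = l := by exact_mod_cast hk'
  have hdvd : (n : ℤ) ∣ l := ⟨k, by rw [← hk2]; ring⟩
  exact h0 (Int.eq_zero_of_abs_lt_dvd hdvd h1)

/-! ### Sums over the odd integers and reflected sums -/

theorem sum_oddIcc (m : ℕ) (f : ℕ → ℝ) :
    ∑ j ∈ oddIcc m, f j = ∑ i ∈ Finset.range ((m + 1) / 2), f (2 * i + 1) := by
  refine (Finset.sum_nbij' (fun i => 2 * i + 1) (fun j => j / 2) ?_ ?_ ?_ ?_ ?_).symm
  · intro i hi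
    simp only [oddIcc, Finset.mem_filter, Finset.mem_Icc, Finset.mem_range] at hi ⊢
    exact ⟨by omega, i, rfl⟩
  · intro j hj
    simp only [oddIcc, Finset.mem_filter, Finset.mem_Icc, Finset.mem_range, Nat.odd_iff] at hj ⊢
    omega
  · intro i _
    omega
  · intro j hj
    simp only [oddIcc, Finset.mem_filter, Finset.mem_Icc, Nat.odd_iff] at hj
    omega
  · intro i _
    rfl

theorem sum_Icc_reflect (m : ℕ) (f : ℕ → ℝ) :
    ∑ k ∈ Finset.Icc 1 m, f (m + 1 - k) = ∑ k ∈ Finset.Icc 1 m, f k := by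
  refine Finset.sum_nbij' (fun k => m + 1 - k) (fun k => m + 1 - k) ?_ ?_ ?_ ?_ ?_ <;>
    intro k hk <;> simp only [Finset.mem_Icc] at hk ⊢ <;> omega

/-! ### The Fejér kernel -/

/-- The Fejér kernel of degree `m`, divided by `m + 1`: thus its value at `0` is `1`. -/
noncomputable def fejerKernel (m : ℕ) (t : ℝ) : ℝ :=
  1 / ((m : ℝ) + 1) ^ 2 *
    ((m : ℝ) + 1 + 2 * ∑ k ∈ Finset.Icc 1 m, ((m : ℝ) + 1 - k) * Real.cos (k * t))

/-- The squared modulus of `∑_{k ≤ m} exp (i k t)`, expanded in cosines. -/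
theorem fejer_expansion (m : ℕ) (t : ℝ) :
    (m : ℝ) + 1 + 2 * ∑ k ∈ Finset.Icc 1 m, ((m : ℝ) + 1 - k) * Real.cos (k * t) =
      (∑ k ∈ Finset.range (m + 1), Real.cos (k * t)) ^ 2 +
        (∑ k ∈ Finset.range (m + 1), Real.sin (k * t)) ^ 2 := by
  induction m with
  | zero => simp
  | succ m ih =>
    -- adding the term `exp (i (m + 1) t)` changes the squared modulus by `1` plus twice this sum
    have hcross : Real.cos ((m + 1 : ℕ) * t) * ∑ k ∈ Finset.range (m + 1), Real.cos (k * t) +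
        Real.sin ((m + 1 : ℕ) * t) * ∑ k ∈ Finset.range (m + 1), Real.sin (k * t) =
        ∑ k ∈ Finset.Icc 1 (m + 1), Real.cos (k * t) := by
      rw [Finset.mul_sum, Finset.mul_sum, ← Finset.sum_add_distrib,
        ← sum_Icc_reflect (m + 1) (fun k => Real.cos (k * t)),
        ← Finset.Ico_add_one_right_eq_Icc, Finset.sum_Ico_eq_sum_range]
      refine Finset.sum_congr rfl fun k hk => ?_
      have hk : k ≤ m := by simp at hk; omega
      rw [← Real.cos_sub]
      congr 1
      rw [show m + 1 + 1 - (1 + k) = m + 1 - k by omega, Nat.cast_sub (by omega : k ≤ m + 1)]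
      push_cast
      ring
    have hsum : ∑ k ∈ Finset.Icc 1 (m + 1), (((m + 1 : ℕ) : ℝ) + 1 - k) * Real.cos (k * t) =
        ∑ k ∈ Finset.Icc 1 m, ((m : ℝ) + 1 - k) * Real.cos (k * t) +
          ∑ k ∈ Finset.Icc 1 (m + 1), Real.cos (k * t) := by
      rw [Finset.sum_Icc_succ_top (by omega), Finset.sum_Icc_succ_top (by omega), ← add_assoc,
        ← Finset.sum_add_distrib]
      congr 1
      · refine Finset.sum_congr rfl fun k _ => ?_
        push_cast; ring
      · push_cast; ring
    rw [hsum, ← hcross, Finset.sum_range_succ _ (m + 1), Finset.sum_range_succ _ (m + 1)]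
    have h1 := Real.sin_sq_add_cos_sq (((m + 1 : ℕ) : ℝ) * t)
    rw [mul_add, ← add_assoc]
    push_cast at *
    linear_combination ih - h1

theorem fejerKernel_nonneg (m : ℕ) (t : ℝ) : 0 ≤ fejerKernel m t := by
  rw [fejerKernel, fejer_expansion]
  positivity

/-- The `m + 1` translates of the normalized Fejér kernel to the odd multiples of `π / (m + 1)`
form a partition of unity. -/
theorem sum_fejerKernel (m : ℕ) (x : ℝ) :
    ∑ i ∈ Finset.range (m + 1),
      fejerKernel m (x - (2 * (i : ℝ) + 1) * (Real.pi / ((m : ℝ) + 1))) = 1 := by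
  have hm : (m : ℝ) + 1 ≠ 0 := by positivity
  simp only [fejerKernel]
  rw [← Finset.mul_sum, Finset.sum_add_distrib, ← Finset.mul_sum, Finset.sum_comm]
  have : ∀ k ∈ Finset.Icc 1 m, ∑ i ∈ Finset.range (m + 1), ((m : ℝ) + 1 - k) *
      Real.cos (k * (x - (2 * (i : ℝ) + 1) * (Real.pi / ((m : ℝ) + 1)))) = 0 := by
    intro k hk
    rw [Finset.mem_Icc] at hk
    rw [← Finset.mul_sum]
    have h := sum_cos_shift_eq_zero (k * x) (k : ℤ) (m + 1) (by omega)
      (sin_mul_pi_div_ne_zero (by omega) (by rw [abs_of_nonneg] <;> omega))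
    refine mul_eq_zero_of_right _ (Eq.trans (Finset.sum_congr rfl fun i _ => ?_) h)
    congr 1
    push_cast
    ring
  rw [Finset.sum_eq_zero this]
  simp
  field_simp

/-! ### Discrete sine and cosine sums at the odd nodes -/

theorem cos_nat_mul_pi_sub (k : ℕ) (y : ℝ) :
    Real.cos (k * Real.pi - y) = (-1) ^ k * Real.cos y := by
  rw [Real.cos_sub, Real.cos_nat_mul_pi, Real.sin_nat_mul_pi]; ring

theorem sin_nat_mul_pi_sub (k : ℕ) (y : ℝ) :
    Real.sin (k * Real.pi - y) = -((-1) ^ k * Real.sin y) := by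
  rw [Real.sin_sub, Real.cos_nat_mul_pi, Real.sin_nat_mul_pi]; ring

/-- The weight `cot (π k / (2 m + 2))` of an odd integer `k`, extended by `0` to even `k`. -/
noncomputable def oddCot (m k : ℕ) : ℝ :=
  if Odd k then Real.cot (Real.pi * k / (2 * (m : ℝ) + 2)) else 0

theorem half_angle_mem (m k : ℕ) (h1 : 1 ≤ k) (h2 : k ≤ m) :
    Real.pi * k / (2 * (m : ℝ) + 2) ∈ Set.Ioo 0 (Real.pi / 2) := by
  have hk : (1 : ℝ) ≤ k := by exact_mod_cast h1
  have hkm : (k : ℝ) ≤ m := by exact_mod_cast h2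
  have := Real.pi_pos
  refine ⟨by positivity, ?_⟩
  rw [div_lt_div_iff₀ (by positivity) (by positivity)]
  nlinarith

theorem cot_half_angle_pos (m k : ℕ) (h1 : 1 ≤ k) (h2 : k ≤ m) :
    0 < Real.cot (Real.pi * k / (2 * (m : ℝ) + 2)) := by
  obtain ⟨ha, hb⟩ := half_angle_mem m k h1 h2
  rw [Real.cot_eq_cos_div_sin]
  exact div_pos (Real.cos_pos_of_mem_Ioo ⟨by linarith, hb⟩)
    (Real.sin_pos_of_pos_of_lt_pi ha (by linarith [Real.pi_pos]))

theorem oddCot_nonneg (m k : ℕ) (h1 : 1 ≤ k) (h2 : k ≤ m) : 0 ≤ oddCot m k := by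
  unfold oddCot
  split_ifs
  exacts [(cot_half_angle_pos m k h1 h2).le, le_rfl]

theorem sum_oddIcc_cot_mul (m : ℕ) (f : ℕ → ℝ) :
    ∑ k ∈ oddIcc m, Real.cot (Real.pi * k / (2 * (m : ℝ) + 2)) * f k =
      ∑ k ∈ Finset.Icc 1 m, oddCot m k * f k := by
  rw [oddIcc, Finset.sum_filter]
  refine Finset.sum_congr rfl fun k _ => ?_
  unfold oddCot
  split_ifs <;> simp

/-- The sine sums over the odd nodes, which are the sine coefficients of the sign function on the
nodes. -/
theorem two_mul_sum_sin_odd_nodes (m k : ℕ) (h1 : 1 ≤ k) (h2 : k ≤ m) :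
    2 * ∑ j ∈ oddIcc m, Real.sin (k * (Real.pi * j / ((m : ℝ) + 1))) =
      oddCot m k + oddCot m (m + 1 - k) := by
  set φ := Real.pi * k / (2 * (m : ℝ) + 2) with hφ
  have hm : (m : ℝ) + 1 ≠ 0 := by positivity
  obtain ⟨ha, hb⟩ := half_angle_mem m k h1 h2
  rw [← hφ] at ha hb
  have hs : 0 < Real.sin φ := Real.sin_pos_of_pos_of_lt_pi ha (by linarith [Real.pi_pos])
  have hc : 0 < Real.cos φ := Real.cos_pos_of_mem_Ioo ⟨by linarith, hb⟩
  have hrefl : Real.pi * ((m + 1 - k : ℕ) : ℝ) / (2 * (m : ℝ) + 2) = Real.pi / 2 - φ := by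
    rw [hφ, Nat.cast_sub (by omega)]
    push_cast
    field_simp
  have hcot' : Real.cot (Real.pi / 2 - φ) = Real.sin φ / Real.cos φ := by
    rw [Real.cot_eq_cos_div_sin, Real.cos_pi_div_two_sub, Real.sin_pi_div_two_sub]
  have key := two_sin_mul_sum_sin (2 * φ) ((m + 1) / 2)
  have hsum : ∑ j ∈ oddIcc m, Real.sin (k * (Real.pi * j / ((m : ℝ) + 1))) =
      ∑ i ∈ Finset.range ((m + 1) / 2), Real.sin ((2 * (i : ℝ) + 1) * (2 * φ)) := by
    rw [sum_oddIcc]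
    refine Finset.sum_congr rfl fun i _ => ?_
    congr 1
    rw [hφ]
    push_cast
    field_simp
  rw [hsum]
  set T := ∑ i ∈ Finset.range ((m + 1) / 2), Real.sin ((2 * (i : ℝ) + 1) * (2 * φ))
  rw [oddCot, oddCot, hrefl, hcot', Real.cot_eq_cos_div_sin, ← hφ]
  rw [Real.sin_two_mul] at key
  have hsc := Real.sin_sq_add_cos_sq φ
  rcases Nat.even_or_odd m with hme | hmo
  -- the telescoped sum ends at `m` if `m` is even and at `m + 1` if `m` is odd
  · have e : 2 * (((m + 1) / 2 : ℕ) : ℝ) * (2 * φ) = k * Real.pi - 2 * φ := by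
      obtain ⟨r, rfl⟩ := hme
      rw [show (r + r + 1) / 2 = r by omega, hφ]
      push_cast at hm ⊢
      field_simp
      ring
    rw [e, cos_nat_mul_pi_sub, Real.cos_two_mul] at key
    rcases Nat.even_or_odd k with hke | hko
    · have h' : Odd (m + 1 - k) := by
        simp only [Nat.odd_iff, Nat.even_iff] at hke hme ⊢
        omega
      rw [hke.neg_one_pow] at key
      rw [if_neg (Nat.not_odd_iff_even.mpr hke), if_pos h', zero_add, eq_div_iff hc.ne']
      apply mul_left_cancel₀ hs.ne'
      linear_combination key / 2 - hsc
    · have h' : ¬ Odd (m + 1 - k) := by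
        simp only [Nat.odd_iff, Nat.even_iff] at hko hme ⊢
        omega
      rw [hko.neg_one_pow] at key
      rw [if_pos hko, if_neg h', add_zero, eq_div_iff hs.ne']
      apply mul_left_cancel₀ hc.ne'
      linear_combination key / 2
  · have e : 2 * (((m + 1) / 2 : ℕ) : ℝ) * (2 * φ) = k * Real.pi := by
      obtain ⟨r, rfl⟩ := hmo
      rw [show (2 * r + 1 + 1) / 2 = r + 1 by omega, hφ]
      push_cast at hm ⊢
      field_simp
      ring
    rw [e, Real.cos_nat_mul_pi] at key
    rcases Nat.even_or_odd k with hke | hko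
    · have h' : ¬ Odd (m + 1 - k) := by
        simp only [Nat.odd_iff, Nat.even_iff] at hke hmo ⊢
        omega
      rw [hke.neg_one_pow] at key
      rw [if_neg (Nat.not_odd_iff_even.mpr hke), if_neg h']
      have h0 : (Real.sin φ * Real.cos φ) * (2 * T) = 0 := by linear_combination key / 2
      simpa [hs.ne', hc.ne'] using h0
    · have h' : Odd (m + 1 - k) := by
        simp only [Nat.odd_iff] at hko hmo ⊢
        omega
      rw [hko.neg_one_pow] at key
      rw [if_pos hko, if_pos h', div_add_div _ _ hs.ne' hc.ne', eq_div_iff (by positivity)]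
      linear_combination key / 2 - hsc

/-- The cosine sum over all nodes modulo `2π` vanishes. For even `m` one of these nodes is `π`,
which does not lie in `(0, π)`; its term `(-1) ^ k` moves to the right with a minus sign. -/
theorem two_mul_sum_cos_odd_nodes (m k : ℕ) (h1 : 1 ≤ k) (h2 : k ≤ m) :
    2 * ∑ j ∈ oddIcc m, Real.cos (k * (Real.pi * j / ((m : ℝ) + 1))) =
      if Even m then -(-1) ^ k else 0 := by
  have hm : (m : ℝ) + 1 ≠ 0 := by positivity
  set θ := (k : ℝ) * Real.pi / ((m : ℝ) + 1) with hθ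
  have hs : Real.sin θ ≠ 0 := by
    have := sin_mul_pi_div_ne_zero (l := (k : ℤ)) (n := m + 1) (by omega)
      (by rw [abs_of_nonneg] <;> omega)
    push_cast at this
    exact this
  have key := two_sin_mul_sum_cos 0 θ ((m + 1) / 2)
  have hsum : ∑ j ∈ oddIcc m, Real.cos (k * (Real.pi * j / ((m : ℝ) + 1))) =
      ∑ i ∈ Finset.range ((m + 1) / 2), Real.cos (0 - (2 * (i : ℝ) + 1) * θ) := by
    rw [sum_oddIcc]
    refine Finset.sum_congr rfl fun i _ => ?_
    rw [zero_sub, Real.cos_neg]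
    congr 1
    rw [hθ]
    push_cast
    field_simp
  rw [hsum]
  rw [Real.sin_zero, zero_sub, zero_sub, Real.sin_neg, neg_neg] at key
  apply mul_left_cancel₀ hs
  split_ifs with hme
  · have e : 2 * (((m + 1) / 2 : ℕ) : ℝ) * θ = k * Real.pi - θ := by
      obtain ⟨r, rfl⟩ := hme
      rw [show (r + r + 1) / 2 = r by omega, hθ]
      push_cast at hm ⊢
      field_simp
      ring
    rw [e, sin_nat_mul_pi_sub] at key
    linear_combination key
  · have e : 2 * (((m + 1) / 2 : ℕ) : ℝ) * θ = k * Real.pi := by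
      obtain ⟨r, rfl⟩ := Nat.not_even_iff_odd.mp hme
      rw [show (2 * r + 1 + 1) / 2 = r + 1 by omega, hθ]
      push_cast at hm ⊢
      field_simp
      ring
    rw [e, Real.sin_nat_mul_pi] at key
    linear_combination key

theorem cot_half_mul_sin_add (k : ℕ) (φ : ℝ) (hφ : Real.sin φ ≠ 0) :
    Real.cot φ * Real.sin ((k + 1 : ℕ) * (2 * φ)) =
      Real.cot φ * Real.sin (k * (2 * φ)) +
        (Real.cos ((k + 1 : ℕ) * (2 * φ)) + Real.cos (k * (2 * φ))) := by
  have e1 : ((k + 1 : ℕ) : ℝ) * (2 * φ) = (2 * k + 1) * φ + φ := by push_cast; ring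
  have e2 : (k : ℝ) * (2 * φ) = (2 * k + 1) * φ - φ := by ring
  rw [e1, e2, Real.cot_eq_cos_div_sin, Real.sin_add, Real.sin_sub, Real.cos_add, Real.cos_sub]
  field_simp
  ring

/-- All the sine moments of the cotangent weights at the odd nodes agree: passing from `k` to
`k + 1` adds cosine sums that cancel. -/
theorem sum_cot_mul_sin (m k : ℕ) (h1 : 1 ≤ k) (h2 : k ≤ m) :
    2 / ((m : ℝ) + 1) * ∑ j ∈ oddIcc m, Real.cot (Real.pi * j / (2 * (m : ℝ) + 2)) *
      Real.sin (k * (Real.pi * j / ((m : ℝ) + 1))) = 1 := by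
  have hm : (m : ℝ) + 1 ≠ 0 := by positivity
  have hstep : ∀ k : ℕ, ∑ j ∈ oddIcc m, Real.cot (Real.pi * j / (2 * (m : ℝ) + 2)) *
      Real.sin ((k + 1 : ℕ) * (Real.pi * j / ((m : ℝ) + 1))) =
      ∑ j ∈ oddIcc m, Real.cot (Real.pi * j / (2 * (m : ℝ) + 2)) *
        Real.sin (k * (Real.pi * j / ((m : ℝ) + 1))) +
      (∑ j ∈ oddIcc m, Real.cos ((k + 1 : ℕ) * (Real.pi * j / ((m : ℝ) + 1))) +
        ∑ j ∈ oddIcc m, Real.cos (k * (Real.pi * j / ((m : ℝ) + 1)))) := by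
    intro k
    rw [← Finset.sum_add_distrib, ← Finset.sum_add_distrib]
    refine Finset.sum_congr rfl fun j hj => ?_
    simp only [oddIcc, Finset.mem_filter, Finset.mem_Icc] at hj
    obtain ⟨ha, hb⟩ := half_angle_mem m j hj.1.1 hj.1.2
    have e : Real.pi * j / ((m : ℝ) + 1) = 2 * (Real.pi * j / (2 * (m : ℝ) + 2)) := by
      field_simp
    rw [e]
    exact cot_half_mul_sin_add k _
      (Real.sin_pos_of_pos_of_lt_pi ha (by linarith [Real.pi_pos])).ne'
  suffices h : 2 * ∑ j ∈ oddIcc m, Real.cot (Real.pi * j / (2 * (m : ℝ) + 2)) *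
      Real.sin (k * (Real.pi * j / ((m : ℝ) + 1))) = (m : ℝ) + 1 by
    rw [div_mul_eq_mul_div, h, div_self hm]
  induction k, h1 using Nat.le_induction with
  | base =>
    have hc := two_mul_sum_cos_odd_nodes m 1 le_rfl h2
    have h := hstep 0
    have hcard : ∑ j ∈ oddIcc m, Real.cos ((0 : ℕ) * (Real.pi * j / ((m : ℝ) + 1))) =
        (((m + 1) / 2 : ℕ) : ℝ) := by
      rw [sum_oddIcc]
      simp
    have h0 : ∑ j ∈ oddIcc m, Real.cot (Real.pi * j / (2 * (m : ℝ) + 2)) *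
        Real.sin ((0 : ℕ) * (Real.pi * j / ((m : ℝ) + 1))) = 0 := by simp
    rw [hcard, h0, zero_add, zero_add] at h
    rw [h, mul_add, hc]
    split_ifs with hme
    · obtain ⟨r, rfl⟩ := hme
      rw [show (r + r + 1) / 2 = r by omega]
      push_cast
      ring
    · obtain ⟨r, rfl⟩ := Nat.not_even_iff_odd.mp hme
      rw [show (2 * r + 1 + 1) / 2 = r + 1 by omega]
      push_cast
      ring
  | succ k hk ih =>
    have hc := two_mul_sum_cos_odd_nodes m k hk (by omega)
    have hc' := two_mul_sum_cos_odd_nodes m (k + 1) (by omega) h2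
    rw [hstep k, mul_add, mul_add, ih (by omega), hc, hc', pow_succ]
    split_ifs <;> ring

/-! ### The sine polynomial -/

/-- The coefficient of `sin kx` in `cotSineSum m x`. The second weight comes from the terms
`k sin (m + 1 - k) x` of the sum, re-indexed by `k ↦ m + 1 - k`. -/
noncomputable def cotSineCoeff (m k : ℕ) : ℝ :=
  2 / ((m : ℝ) + 1) ^ 2 * (((m : ℝ) + 1 - k) * (oddCot m k + oddCot m (m + 1 - k)))

theorem cotSineSum_eq_sum (m : ℕ) (x : ℝ) :
    cotSineSum m x = ∑ k ∈ Finset.Icc 1 m, cotSineCoeff m k * Real.sin (k * x) := by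
  have hterm : cotSineSum m x = 2 / ((m : ℝ) + 1) ^ 2 *
      (∑ k ∈ Finset.Icc 1 m, oddCot m k * (((m : ℝ) + 1 - k) * Real.sin (k * x)) +
        ∑ k ∈ Finset.Icc 1 m, oddCot m k * (k * Real.sin (((m : ℝ) + 1 - k) * x))) := by
    rw [← Finset.sum_add_distrib]
    simp only [← mul_add]
    rw [← sum_oddIcc_cot_mul m
      fun k => ((m : ℝ) + 1 - k) * Real.sin (k * x) + k * Real.sin (((m : ℝ) + 1 - k) * x),
      cotSineSum, Finset.mul_sum]
    exact Finset.sum_congr rfl fun k _ => by ring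
  rw [hterm, ← sum_Icc_reflect m fun k => oddCot m k * (k * Real.sin (((m : ℝ) + 1 - k) * x)),
    ← Finset.sum_add_distrib, Finset.mul_sum]
  refine Finset.sum_congr rfl fun k hk => ?_
  rw [Finset.mem_Icc] at hk
  rw [cotSineCoeff, Nat.cast_sub (by omega : k ≤ m + 1)]
  push_cast
  rw [sub_sub_cancel]
  ring

theorem cotSineCoeff_nonneg (m k : ℕ) (h1 : 1 ≤ k) (h2 : k ≤ m) : 0 ≤ cotSineCoeff m k := by
  have h : (k : ℝ) ≤ m := by exact_mod_cast h2
  have ha := oddCot_nonneg m k h1 h2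
  have hb := oddCot_nonneg m (m + 1 - k) (by omega) (by omega)
  have hc : 0 ≤ (m : ℝ) + 1 - k := by linarith
  unfold cotSineCoeff
  positivity

theorem sum_cotSineCoeff (m : ℕ) : ∑ k ∈ Finset.Icc 1 m, cotSineCoeff m k = cotConst m := by
  have hm : (m : ℝ) + 1 ≠ 0 := by positivity
  have hsplit : ∑ k ∈ Finset.Icc 1 m, cotSineCoeff m k = 2 / ((m : ℝ) + 1) ^ 2 *
      (∑ k ∈ Finset.Icc 1 m, ((m : ℝ) + 1 - k) * oddCot m k +
        ∑ k ∈ Finset.Icc 1 m, (k : ℝ) * oddCot m k) := by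
    rw [← sum_Icc_reflect m fun k => (k : ℝ) * oddCot m k, ← Finset.sum_add_distrib,
      Finset.mul_sum]
    refine Finset.sum_congr rfl fun k hk => ?_
    rw [Finset.mem_Icc] at hk
    rw [cotSineCoeff, Nat.cast_sub (by omega : k ≤ m + 1)]
    push_cast
    ring
  have hcot := sum_oddIcc_cot_mul m fun _ => 1
  simp only [mul_one] at hcot
  rw [hsplit, cotConst, hcot, ← Finset.sum_add_distrib, Finset.mul_sum, Finset.mul_sum]
  refine Finset.sum_congr rfl fun k _ => ?_
  field_simp
  ring

/-- The sine polynomial is the Hermite–Fejér interpolant of the sign of the node at the odd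
multiples of `π / (m + 1)` in `(-π, π)`. -/
theorem cotSineSum_eq_sum_fejerKernel (m : ℕ) (x : ℝ) :
    cotSineSum m x = ∑ j ∈ oddIcc m, (fejerKernel m (x - Real.pi * j / ((m : ℝ) + 1)) -
      fejerKernel m (x + Real.pi * j / ((m : ℝ) + 1))) := by
  have hdiff : ∀ y : ℝ, fejerKernel m (x - y) - fejerKernel m (x + y) =
      ∑ k ∈ Finset.Icc 1 m, 4 / ((m : ℝ) + 1) ^ 2 * (((m : ℝ) + 1 - k) * Real.sin (k * x)) *
        Real.sin (k * y) := by
    intro y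
    rw [fejerKernel, fejerKernel, ← mul_sub, add_sub_add_left_eq_sub, ← mul_sub,
      ← Finset.sum_sub_distrib, Finset.mul_sum, Finset.mul_sum]
    refine Finset.sum_congr rfl fun k _ => ?_
    rw [mul_sub (k : ℝ), mul_add (k : ℝ), Real.cos_add, Real.cos_sub]
    ring
  simp only [hdiff]
  rw [Finset.sum_comm, cotSineSum_eq_sum]
  refine Finset.sum_congr rfl fun k hk => ?_
  rw [Finset.mem_Icc] at hk
  rw [← Finset.mul_sum, cotSineCoeff, ← two_mul_sum_sin_odd_nodes m k hk.1 hk.2]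
  ring

theorem cotSineSum_le_one (m : ℕ) (x : ℝ) : cotSineSum m x ≤ 1 := by
  rw [cotSineSum_eq_sum_fejerKernel]
  calc ∑ j ∈ oddIcc m, (fejerKernel m (x - Real.pi * j / ((m : ℝ) + 1)) -
        fejerKernel m (x + Real.pi * j / ((m : ℝ) + 1)))
      ≤ ∑ j ∈ oddIcc m, fejerKernel m (x - Real.pi * j / ((m : ℝ) + 1)) :=
        Finset.sum_le_sum fun j _ => sub_le_self _ (fejerKernel_nonneg _ _)
    _ = ∑ i ∈ Finset.range ((m + 1) / 2),
          fejerKernel m (x - (2 * (i : ℝ) + 1) * (Real.pi / ((m : ℝ) + 1))) := by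
        rw [sum_oddIcc]
        refine Finset.sum_congr rfl fun i _ => ?_
        congr 2
        push_cast
        ring
    _ ≤ ∑ i ∈ Finset.range (m + 1),
          fejerKernel m (x - (2 * (i : ℝ) + 1) * (Real.pi / ((m : ℝ) + 1))) :=
        Finset.sum_le_sum_of_subset_of_nonneg
          (Finset.range_subset_range.mpr (Nat.div_le_self _ _))
          fun _ _ _ => fejerKernel_nonneg _ _
    _ = 1 := sum_fejerKernel m x

/-- Discrete orthogonality of the sines. The grid has `2 m + 2` points so that `k + l` is not a
multiple of its size. -/
theorem sum_sin_mul_sin (m k l : ℕ) (hk : k ∈ Finset.Icc 1 m) (hl : l ∈ Finset.Icc 1 m) :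
    ∑ i ∈ Finset.range (2 * m + 2),
      Real.sin (k * ((2 * (i : ℝ) + 1) * (Real.pi / (2 * m + 2)))) *
        Real.sin (l * ((2 * (i : ℝ) + 1) * (Real.pi / (2 * m + 2)))) =
      if k = l then (m : ℝ) + 1 else 0 := by
  rw [Finset.mem_Icc] at hk hl
  have hzero : ∀ r : ℤ, r ≠ 0 → |r| < (2 * m + 2 : ℕ) → ∑ i ∈ Finset.range (2 * m + 2),
      Real.cos (r * ((2 * (i : ℝ) + 1) * (Real.pi / (2 * m + 2)))) = 0 := by
    intro r h0 h1
    rw [← sum_cos_shift_eq_zero 0 r (2 * m + 2) (by omega) (sin_mul_pi_div_ne_zero h0 h1)]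
    refine Finset.sum_congr rfl fun i _ => ?_
    rw [zero_sub, Real.cos_neg]
    congr 1
    push_cast
    ring
  have hprod : ∀ y : ℝ, Real.sin (k * y) * Real.sin (l * y) =
      1 / 2 * Real.cos (((k - l : ℤ) : ℝ) * y) - 1 / 2 * Real.cos (((k + l : ℤ) : ℝ) * y) := by
    intro y
    push_cast
    rw [sub_mul, add_mul, Real.cos_sub, Real.cos_add]
    ring
  simp only [hprod]
  rw [Finset.sum_sub_distrib, ← Finset.mul_sum, ← Finset.mul_sum,
    hzero (k + l) (by omega) (by rw [abs_of_nonneg] <;> omega)]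
  split_ifs with h
  · subst h
    simp
    ring
  · rw [hzero (k - l) (by omega) (by rw [abs_lt]; omega)]
    simp

theorem sine_coeff_unique (m : ℕ) (a b : ℕ → ℝ)
    (h : ∀ x : ℝ, ∑ k ∈ Finset.Icc 1 m, a k * Real.sin (k * x) =
      ∑ k ∈ Finset.Icc 1 m, b k * Real.sin (k * x)) :
    ∀ k ∈ Finset.Icc 1 m, a k = b k := by
  have hm : (m : ℝ) + 1 ≠ 0 := by positivity
  have key : ∀ c : ℕ → ℝ, ∀ l ∈ Finset.Icc 1 m, ∑ i ∈ Finset.range (2 * m + 2),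
      (∑ k ∈ Finset.Icc 1 m, c k *
        Real.sin (k * ((2 * (i : ℝ) + 1) * (Real.pi / (2 * m + 2))))) *
        Real.sin (l * ((2 * (i : ℝ) + 1) * (Real.pi / (2 * m + 2)))) = c l * ((m : ℝ) + 1) := by
    intro c l hl
    simp only [Finset.sum_mul, mul_assoc (c _)]
    rw [Finset.sum_comm]
    simp only [← Finset.mul_sum]
    rw [Finset.sum_congr rfl fun k hk => by rw [sum_sin_mul_sin m k l hk hl]]
    simp [hl]
  intro l hl
  apply mul_right_cancel₀ hm
  rw [← key a l hl, ← key b l hl]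
  simp only [h]

/-! ### The extremal measure -/

theorem cotConst_pos (m : ℕ) (hm : 1 ≤ m) : 0 < cotConst m := by
  refine mul_pos (by positivity) (Finset.sum_pos (fun j hj => ?_) ⟨1, ?_⟩)
  · simp only [oddIcc, Finset.mem_filter, Finset.mem_Icc] at hj
    exact cot_half_angle_pos m j hj.1.1 hj.1.2
  · simp [oddIcc, hm]

theorem cotMeasure_weight_nonneg (m : ℕ) (hm : 1 ≤ m) (j : ℕ) (hj : j ∈ oddIcc m) :
    0 ≤ 2 / (((m : ℝ) + 1) * cotConst m) * Real.cot (Real.pi * j / (2 * (m : ℝ) + 2)) := by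
  simp only [oddIcc, Finset.mem_filter, Finset.mem_Icc] at hj
  have := cotConst_pos m hm
  have := cot_half_angle_pos m j hj.1.1 hj.1.2
  positivity

theorem isProbabilityMeasure_cotMeasure (m : ℕ) (hm : 1 ≤ m) :
    MeasureTheory.IsProbabilityMeasure (cotMeasure m) := by
  have hc := cotConst_pos m hm
  have hm' : (m : ℝ) + 1 ≠ 0 := by positivity
  constructor
  simp only [cotMeasure, MeasureTheory.Measure.finsetSum_apply, MeasureTheory.Measure.smul_apply,
    MeasureTheory.measure_univ, smul_eq_mul, mul_one]
  rw [← ENNReal.ofReal_sum_of_nonneg (cotMeasure_weight_nonneg m hm), ← Finset.mul_sum,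
    ← ENNReal.ofReal_one]
  congr 1
  have h : 2 / (((m : ℝ) + 1) * cotConst m) *
      ∑ j ∈ oddIcc m, Real.cot (Real.pi * j / (2 * (m : ℝ) + 2)) =
      cotConst m / cotConst m := by
    rw [eq_div_iff hc.ne', cotConst] at *
    field_simp
  rw [h, div_self hc.ne']

theorem integral_sin_cotMeasure (m k : ℕ) (h1 : 1 ≤ k) (h2 : k ≤ m) :
    ∫ x, Real.sin (k * x) ∂(cotMeasure m) = 1 / cotConst m := by
  rw [cotMeasure, MeasureTheory.integral_finsetSum_measure]
  · have h := sum_cot_mul_sin m k h1 h2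
    rw [Finset.mul_sum] at h
    conv_rhs => rw [← h, Finset.sum_div]
    refine Finset.sum_congr rfl fun j hj => ?_
    rw [MeasureTheory.integral_smul_measure, MeasureTheory.integral_dirac,
      ENNReal.toReal_ofReal (cotMeasure_weight_nonneg m (h1.trans h2) j hj), smul_eq_mul]
    have := (cotConst_pos m (h1.trans h2)).ne'
    field_simp
  · intro j _
    exact (MeasureTheory.integrable_dirac (by simp)).smul_measure ENNReal.ofReal_ne_top

theorem integrable_sin_mul (μ : MeasureTheory.Measure ℝ) [MeasureTheory.IsProbabilityMeasure μ]
    (r : ℝ) : MeasureTheory.Integrable (fun x => Real.sin (r * x)) μ :=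
  MeasureTheory.Integrable.of_bound (by fun_prop) 1
    (Filter.Eventually.of_forall fun x => by simpa using Real.abs_sin_le_one (r * x))

/-- The minimum is at most the mean of the sine moments with weights `cotSineCoeff m k`, and that
mean is the integral of `cotSineSum m`, divided by `cotConst m`. -/
theorem minSineExpectation_le (m : ℕ) (hm : 1 ≤ m) (μ : MeasureTheory.Measure ℝ)
    [MeasureTheory.IsProbabilityMeasure μ] : minSineExpectation m hm μ ≤ 1 / cotConst m := by
  rw [le_div_iff₀ (cotConst_pos m hm), mul_comm, ← sum_cotSineCoeff, Finset.sum_mul]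
  calc ∑ k ∈ Finset.Icc 1 m, cotSineCoeff m k * minSineExpectation m hm μ
      ≤ ∑ k ∈ Finset.Icc 1 m, cotSineCoeff m k * ∫ x, Real.sin ((k : ℝ) * x) ∂μ := by
        refine Finset.sum_le_sum fun k hk => mul_le_mul_of_nonneg_left ?_ ?_
        · exact Finset.inf'_le _ hk
        · rw [Finset.mem_Icc] at hk
          exact cotSineCoeff_nonneg m k hk.1 hk.2
    _ = ∫ x, cotSineSum m x ∂μ := by
        simp only [cotSineSum_eq_sum]
        rw [MeasureTheory.integral_finsetSum _ fun (k : ℕ) _ =>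
          (integrable_sin_mul μ k).const_mul (cotSineCoeff m k)]
        simp only [MeasureTheory.integral_const_mul]
    _ ≤ ∫ _, (1 : ℝ) ∂μ := by
        refine MeasureTheory.integral_mono ?_ (MeasureTheory.integrable_const _)
          (cotSineSum_le_one m)
        rw [funext (cotSineSum_eq_sum m)]
        exact MeasureTheory.integrable_finsetSum _ fun (k : ℕ) _ =>
          (integrable_sin_mul μ k).const_mul (cotSineCoeff m k)
    _ = 1 := by simp

theorem minSineExpectation_cotMeasure (m : ℕ) (hm : 1 ≤ m) :
    minSineExpectation m hm (cotMeasure m) = 1 / cotConst m := by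
  rw [minSineExpectation]
  refine le_antisymm ?_ (Finset.le_inf' _ _ fun k hk => ?_)
  · exact (Finset.inf'_le _ (Finset.mem_Icc.mpr ⟨le_rfl, hm⟩)).trans_eq
      (integral_sin_cotMeasure m 1 le_rfl hm)
  · rw [Finset.mem_Icc] at hk
    exact (integral_sin_cotMeasure m k hk.1 hk.2).ge

/-- Testing a sine polynomial bounded by `1` against the cotangent weights at the odd nodes yields
the sum of its coefficients. -/
theorem sum_coeff_le_cotConst (m : ℕ) (b : ℕ → ℝ)
    (hb : ∀ x : ℝ, ∑ k ∈ Finset.Icc 1 m, b k * Real.sin ((k : ℝ) * x) ≤ 1) :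
    ∑ k ∈ Finset.Icc 1 m, b k ≤ cotConst m := by
  calc ∑ k ∈ Finset.Icc 1 m, b k
      = ∑ k ∈ Finset.Icc 1 m, b k * (2 / ((m : ℝ) + 1) *
          ∑ j ∈ oddIcc m, Real.cot (Real.pi * j / (2 * (m : ℝ) + 2)) *
            Real.sin (k * (Real.pi * j / ((m : ℝ) + 1)))) := by
        refine Finset.sum_congr rfl fun k hk => ?_
        rw [Finset.mem_Icc] at hk
        rw [sum_cot_mul_sin m k hk.1 hk.2, mul_one]
    _ = 2 / ((m : ℝ) + 1) * ∑ j ∈ oddIcc m, Real.cot (Real.pi * j / (2 * (m : ℝ) + 2)) *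
          ∑ k ∈ Finset.Icc 1 m, b k * Real.sin (k * (Real.pi * j / ((m : ℝ) + 1))) := by
        simp only [Finset.mul_sum]
        rw [Finset.sum_comm]
        exact Finset.sum_congr rfl fun j _ => Finset.sum_congr rfl fun k _ => by ring
    _ ≤ cotConst m := by
        refine mul_le_mul_of_nonneg_left (Finset.sum_le_sum fun j hj => ?_) (by positivity)
        simp only [oddIcc, Finset.mem_filter, Finset.mem_Icc] at hj
        exact mul_le_of_le_one_right (cot_half_angle_pos m j hj.1.1 hj.1.2).le (hb _)

theorem theorem3 (m : ℕ) (hm : 1 ≤ m) :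
    -- (i) the inequality, and the signs and the sum of its (uniquely determined) coefficients
    (∀ x : ℝ, cotSineSum m x ≤ 1) ∧
    (∃ a : ℕ → ℝ,
      (∀ x : ℝ, cotSineSum m x = ∑ k ∈ Finset.Icc 1 m, a k * Real.sin ((k : ℝ) * x)) ∧
      (∀ b : ℕ → ℝ,
        (∀ x : ℝ, cotSineSum m x = ∑ k ∈ Finset.Icc 1 m, b k * Real.sin ((k : ℝ) * x)) →
        ∀ k ∈ Finset.Icc 1 m, b k = a k) ∧
      (∀ k ∈ Finset.Icc 1 m, 0 ≤ a k) ∧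
      ∑ k ∈ Finset.Icc 1 m, a k = cotConst m) ∧
    -- (ii) the bound for all probability measures, with equality for the explicit measure
    0 < cotConst m ∧
    (∀ μ : MeasureTheory.Measure ℝ, MeasureTheory.IsProbabilityMeasure μ →
      minSineExpectation m hm μ ≤ 1 / cotConst m) ∧
    MeasureTheory.IsProbabilityMeasure (cotMeasure m) ∧
    minSineExpectation m hm (cotMeasure m) = 1 / cotConst m ∧
    -- optimality of the inequality in (i)
    (∀ b : ℕ → ℝ,
      (∀ x : ℝ, ∑ k ∈ Finset.Icc 1 m, b k * Real.sin ((k : ℝ) * x) ≤ 1) →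
      ∑ k ∈ Finset.Icc 1 m, b k ≤ cotConst m) := by

  refine ⟨cotSineSum_le_one m, ⟨cotSineCoeff m, cotSineSum_eq_sum m, fun b hb => ?_,
    fun k hk => ?_, sum_cotSineCoeff m⟩, cotConst_pos m hm, fun μ _ => minSineExpectation_le m hm μ,
    isProbabilityMeasure_cotMeasure m hm, minSineExpectation_cotMeasure m hm,
    sum_coeff_le_cotConst m⟩
  · exact sine_coeff_unique m b (cotSineCoeff m) fun x => by rw [← hb, cotSineSum_eq_sum]
  · rw [Finset.mem_Icc] at hk
    exact cotSineCoeff_nonneg m k hk.1 hk.2
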